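/- Let $\mathbf{k}$ be a field of characteristic zero. All operads are nonsymmetric operads over $\mathbf{k}$; $\mathcal{T}(E)$ denotes the free operad on an arity graded space $E=\{0,E_1,E_2,0,\dots\}$, and $\mathcal{T}(E)/\langle R\rangle$ the quotient by the operadic ideal generated by $R$. For a quadratic presentation $\mathcal{P}=\mathcal{T}(E)/\langle R\rangle$ with $E_1,E_2$ finite dimensional and $R=R_1\sqcup R_2\sqcup R_3$ sorted by arity ($R_1\subseteq E_1\otimes E_1$ spanned by trees $\alpha\circ_1\beta$; $R_2$ in the span of $\alpha\circ_1\mu,\ \mu\circ_1\alpha,\ \mu\circ_2\alpha$; $R_3$ in the span of $\mu\circ_1\nu,\ \mu\circ_2\nu$, with $\alpha,\beta\in E_1$, $\mu,\nu\in E_2$), the *Koszul dual operad* is $\mathcal{P}^!=\mathcal{T}(E^*)/\langle R_1^\perp, R_2^\perp, R_3^\perp\rangle$, where the orthogonal spaces are taken for the bilinear pairing of $\mathcal{T}(E^*)^{(2)}$ with $\mathcal{T}(E)^{(2)}$ given by $\langle a^*\circ_i b^*,a\circ_i b\rangle=\varepsilon\, a^*(a)b^*(b)$, with $\varepsilon=-1$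 for $\alpha^*\circ_1\mu^*$ and for $\mu^*\circ_2\nu^*$, $\varepsilon=1$ for $\alpha^*\circ_1\beta^*$, $\mu^*\circ_1\alpha^*$, $\mu^*\circ_2\alpha^*$ and $\mu^*\circ_1\nu^*$, and by $0$ on pairs of trees of different shapes. The operad $\mathcal{P}$ is *self-dual* if $\mathcal{P}^!\cong\mathcal{P}$ as nonsymmetric operads. Given bases $(P_k)$ of $E_1$ and $(i)$ of $E_2$ and a nonempty set $\Omega$, the *matching operad* $\mathrm{mat}(\mathcal{P})_\Omega$ has generators $P_{\omega,k}$, $i_\omega$ ($\omega\in\Omega$) and relations $r^{\mu,\nu}$ for all $r\in R$ and all $\mu,\nu\in\Omega$, where $r^{\mu,\nu}$ is obtained from $r$ by replacing $P_\ell\circ_1P_k$ by $P_{\nu,\ell}\circ_1P_{\mu,k}$ in arity one; $P_k$ by $P_{\mu,k}$ and $i$ by $i_\nu$ in arity two; and $j\circ_1 i$ by $j_\nu\circ_1 i_\mu$ and $i\circ_2 j$ by $i_\mu\circ_2 j_\nu$ in arity three. Let $\mathcal{P}$ be the operad with two unary generators $d_1,d_2$, one binary generator $\cdot$, and the relations $$d_1(d_1(x))=0,\quad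 d_1(d_2(x))=0,\quad d_1(x\cdot y)=d_1(x)\cdot y+x\cdot d_1(y),$$ $$d_2(x\cdot y)=d_2(x)\cdot y,\quad d_2(x\cdot y)=x\cdot d_2(y),\quad (x\cdot y)\cdot z=x\cdot(y\cdot z).$$ Then: 1. $\mathcal{P}$ is self-dual. 2. For every nonempty finite set $\Omega$, the operad $\mathrm{mat}(\mathcal{P})_\Omega$ is self-dual. -/

import Mathlib

/-! Nonsymmetric operads over a field, presented through partial compositions. -/

/-- A nonsymmetric operad over `k`: `circ i _ _ x y` is the partial composition `x ∘ᵢ y` (with `i`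
counted from `0`) of `x` of arity `m` with `y` of arity `n`; the result has arity
`p = m + n - 1`. -/
structure NSOperad (k : Type*) [Field k] where
  Op : ℕ → Type*
  [addCommGroup : ∀ n, AddCommGroup (Op n)]
  [module : ∀ n, Module k (Op n)]
  one : Op 1
  circ : ∀ {m n p : ℕ} (i : ℕ), i < m → p + 1 = m + n → Op m →ₗ[k] Op n →ₗ[k] Op p
  one_circ : ∀ {n : ℕ} (h : n + 1 = 1 + n) (x : Op n), circ 0 Nat.one_pos h one x = x
  circ_one : ∀ {m : ℕ} (i : ℕ) (hi : i < m) (x : Op m), circ i hi rfl x one = x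
  /-- sequential composition: `(x ∘ᵢ y) ∘ᵢ₊ⱼ z = x ∘ᵢ (y ∘ⱼ z)` -/
  circ_assoc : ∀ {l m n p q r : ℕ} (i j : ℕ) (hi : i < l) (hj : j < m) (hij : i + j < p)
    (h₁ : p + 1 = l + m) (h₂ : r + 1 = p + n) (h₃ : q + 1 = m + n) (h₄ : r + 1 = l + q)
    (x : Op l) (y : Op m) (z : Op n),
    circ (i + j) hij h₂ (circ i hi h₁ x y) z = circ i hi h₄ x (circ j hj h₃ y z)
  /-- parallel composition: `(x ∘ᵢ y) ∘ⱼ₊ₘ₋₁ z = (x ∘ⱼ z) ∘ᵢ y` for `i < j` -/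
  circ_comm : ∀ {l m n p q r : ℕ} (i j j' : ℕ) (hi : i < l) (hj : j < l) (_ : i < j)
    (_ : j' + 1 = j + m) (hj' : j' < p) (hi' : i < q)
    (h₁ : p + 1 = l + m) (h₂ : r + 1 = p + n) (h₃ : q + 1 = l + n) (h₄ : r + 1 = q + m)
    (x : Op l) (y : Op m) (z : Op n),
    circ j' hj' h₂ (circ i hi h₁ x y) z = circ i hi' h₄ (circ j hj h₃ x z) y

namespace NSOperad

attribute [instance] NSOperad.addCommGroup NSOperad.module

variable {k : Type*} [Field k]

/-- An isomorphism of nonsymmetric operads: arity-wise linear isomorphisms compatible with the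
identity operation and with all compositions. -/
structure Iso (P Q : NSOperad k) where
  equiv : ∀ n, P.Op n ≃ₗ[k] Q.Op n
  map_one : equiv 1 P.one = Q.one
  map_circ : ∀ {m n p : ℕ} (i : ℕ) (hi : i < m) (h : p + 1 = m + n) (x : P.Op m) (y : P.Op n),
    equiv p (P.circ i hi h x y) = Q.circ i hi h (equiv m x) (equiv n y)

/-- Operadic ideals. -/
structure IsIdeal (P : NSOperad k) (I : ∀ n, Submodule k (P.Op n)) : Prop where
  left : ∀ {m n p : ℕ} (i : ℕ) (hi : i < m) (h : p + 1 = m + n) (x : P.Op m) (y : P.Op n),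
    x ∈ I m → P.circ i hi h x y ∈ I p
  right : ∀ {m n p : ℕ} (i : ℕ) (hi : i < m) (h : p + 1 = m + n) (x : P.Op m) (y : P.Op n),
    y ∈ I n → P.circ i hi h x y ∈ I p

/-- The operadic ideal generated by a family of elements. -/
def idealSpan (P : NSOperad k) (R : ∀ n, Set (P.Op n)) (n : ℕ) : Submodule k (P.Op n) :=
  ⨅ I : {I : ∀ n, Submodule k (P.Op n) // P.IsIdeal I ∧ ∀ n, R n ⊆ I n}, I.1 n

theorem idealSpan_isIdeal (P : NSOperad k) (R : ∀ n, Set (P.Op n)) :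
    P.IsIdeal (P.idealSpan R) where
  left i hi h x y hx := by
    simp only [idealSpan, Submodule.mem_iInf] at hx ⊢
    exact fun I => I.2.1.left i hi h x y (hx I)
  right i hi h x y hy := by
    simp only [idealSpan, Submodule.mem_iInf] at hy ⊢
    exact fun I => I.2.1.right i hi h x y (hy I)

/-- The composition induced on the quotient by an ideal. -/
def quotCirc (P : NSOperad k) (I : ∀ n, Submodule k (P.Op n)) (hI : P.IsIdeal I) {m n p : ℕ}
    (i : ℕ) (hi : i < m) (h : p + 1 = m + n) :
    (P.Op m ⧸ I m) →ₗ[k] (P.Op n ⧸ I n) →ₗ[k] (P.Op p ⧸ I p) :=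
  (Submodule.liftQ (I n)
    (Submodule.liftQ (I m) ((P.circ i hi h).compr₂ (I p).mkQ) (by
      intro x hx
      rw [LinearMap.mem_ker]
      ext y
      exact (Submodule.Quotient.mk_eq_zero _).2 (hI.left i hi h x y hx))).flip (by
      intro y hy
      rw [LinearMap.mem_ker]
      ext x
      exact (Submodule.Quotient.mk_eq_zero _).2 (hI.right i hi h x y hy))).flip

theorem quotCirc_mk (P : NSOperad k) (I : ∀ n, Submodule k (P.Op n)) (hI : P.IsIdeal I)
    {m n p : ℕ} (i : ℕ) (hi : i < m) (h : p + 1 = m + n) (x : P.Op m) (y : P.Op n) :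
    P.quotCirc I hI i hi h ((I m).mkQ x) ((I n).mkQ y) = (I p).mkQ (P.circ i hi h x y) := rfl

/-- The quotient of an operad by an operadic ideal. -/
def quot (P : NSOperad k) (I : ∀ n, Submodule k (P.Op n)) (hI : P.IsIdeal I) : NSOperad k where
  Op n := P.Op n ⧸ I n
  one := (I 1).mkQ P.one
  circ i hi h := P.quotCirc I hI i hi h
  one_circ {n} h x := by
    obtain ⟨x, rfl⟩ := (I n).mkQ_surjective x
    rw [quotCirc_mk, P.one_circ]
  circ_one {m} i hi x := by
    obtain ⟨x, rfl⟩ := (I m).mkQ_surjective x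
    rw [quotCirc_mk, P.circ_one]
  circ_assoc {l m n p q r} i j hi hj hij h₁ h₂ h₃ h₄ x y z := by
    obtain ⟨x, rfl⟩ := (I l).mkQ_surjective x
    obtain ⟨y, rfl⟩ := (I m).mkQ_surjective y
    obtain ⟨z, rfl⟩ := (I n).mkQ_surjective z
    simp only [quotCirc_mk]
    rw [P.circ_assoc i j hi hj hij h₁ h₂ h₃ h₄]
  circ_comm {l m n p q r} i j j' hi hj hlt hj'eq hj' hi' h₁ h₂ h₃ h₄ x y z := by
    obtain ⟨x, rfl⟩ := (I l).mkQ_surjective x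
    obtain ⟨y, rfl⟩ := (I m).mkQ_surjective y
    obtain ⟨z, rfl⟩ := (I n).mkQ_surjective z
    simp only [quotCirc_mk]
    rw [P.circ_comm i j j' hi hj hlt hj'eq hj' hi' h₁ h₂ h₃ h₄]

end NSOperad

/-- Planar rooted trees with unary vertices decorated by `U` and binary vertices decorated
by `B`. The outermost constructor is the vertex next to the root. -/
inductive PTree (U B : Type*) where
  | leaf : PTree U B
  | un : U → PTree U B → PTree U B
  | bin : B → PTree U B → PTree U B → PTree U B

namespace PTree

variable {U B : Type*}

/-- The number of leaves. -/
def leaves : PTree U B → ℕ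
  | leaf => 1
  | un _ t => t.leaves
  | bin _ l r => l.leaves + r.leaves

/-- `t.graft i s` grafts the root of `s` to the leaf number `i` of `t`
(leaves are counted from the left, starting with `0`). -/
def graft : PTree U B → ℕ → PTree U B → PTree U B
  | leaf, _, s => s
  | un a t, i, s => un a (t.graft i s)
  | bin b l r, i, s =>
    if i < l.leaves then bin b (l.graft i s) r else bin b l (r.graft (i - l.leaves) s)

theorem leaves_graft (t s : PTree U B) (i : ℕ) (hi : i < t.leaves) :
    (t.graft i s).leaves + 1 = t.leaves + s.leaves := by
  induction t generalizing i with
  | leaf => simp [graft, leaves, add_comm]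
  | un a t ih => exact ih i hi
  | bin b l r ihl ihr =>
    simp only [graft, leaves] at hi ⊢
    split_ifs with h
    · have := ihl i h
      simp only [leaves]; omega
    · have := ihr (i - l.leaves) (by omega)
      simp only [leaves]; omega

theorem graft_leaf (t : PTree U B) (i : ℕ) : t.graft i leaf = t := by
  induction t generalizing i with
  | leaf => rfl
  | un a t ih => simp [graft, ih]
  | bin b l r ihl ihr => simp [graft, ihl, ihr]

theorem graft_assoc (t s r : PTree U B) (i j : ℕ) (hi : i < t.leaves) (hj : j < s.leaves) :
    (t.graft i s).graft (i + j) r = t.graft i (s.graft j r) := by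
  induction t generalizing i with
  | leaf =>
    have : i = 0 := by simp only [leaves] at hi; omega
    simp [graft, this]
  | un a t ih => simp only [graft]; rw [ih i hi]
  | bin b u v ihu ihv =>
    simp only [leaves] at hi
    by_cases h : i < u.leaves
    · have h1 := leaves_graft u s i h
      have h2 : i + j < (u.graft i s).leaves := by omega
      simp only [graft, h, if_true, h2]
      rw [ihu i h]
    · have h2 : ¬ i + j < u.leaves := by omega
      have h3 : i + j - u.leaves = (i - u.leaves) + j := by omega
      simp only [graft, h, if_false, h2]
      rw [h3, ihv (i - u.leaves) (by omega)]

theorem graft_comm (t s r : PTree U B) (i j j' : ℕ) (hij : i < j) (hj : j < t.leaves)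
    (hj' : j' + 1 = j + s.leaves) :
    (t.graft i s).graft j' r = (t.graft j r).graft i s := by
  induction t generalizing i j j' with
  | leaf => simp only [leaves] at hj; omega
  | un a t ih => simp only [graft]; rw [ih i j j' hij hj hj']
  | bin b u v ihu ihv =>
    simp only [leaves] at hj
    by_cases h : i < u.leaves
    · have h1 := leaves_graft u s i h
      by_cases h' : j < u.leaves
      · have h1' := leaves_graft u r j h'
        have h2 : j' < (u.graft i s).leaves := by omega
        have h3 : i < (u.graft j r).leaves := by
          by_contra hc
          have : 0 < r.leaves := by
            clear * -
            induction r with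
            | leaf => simp [leaves]
            | un a t ih => exact ih
            | bin b u v ihu ihv => simp only [leaves]; omega
          omega
        simp only [graft, h, h', if_true, h2, h3]
        rw [ihu i j j' hij h' hj']
      · have h2 : ¬ j' < (u.graft i s).leaves := by omega
        have h3 : j' - (u.graft i s).leaves = j - u.leaves := by omega
        simp only [graft, h, h', if_true, if_false, h2, h3]
    · have h' : ¬ j < u.leaves := by omega
      have h2 : ¬ j' < u.leaves := by omega
      simp only [graft, h, h', if_false, h2]
      rw [ihv (i - u.leaves) (j - u.leaves) (j' - u.leaves) (by omega) (by omega) (by omega)]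

end PTree

/-- Decorated planar rooted trees with exactly `n` leaves. -/
abbrev TreeN (U B : Type*) (n : ℕ) : Type _ := {t : PTree U B // t.leaves = n}

namespace TreeN

variable {U B : Type*}

/-- Grafting of trees with prescribed numbers of leaves. -/
def circ {m n p : ℕ} (i : ℕ) (hi : i < m) (h : p + 1 = m + n) (t : TreeN U B m)
    (s : TreeN U B n) : TreeN U B p :=
  ⟨t.1.graft i s.1, by
    have := PTree.leaves_graft t.1 s.1 i (by rw [t.2]; exact hi)
    rw [t.2, s.2] at this; omega⟩

end TreeN

section Free

variable (k : Type*) [Field k] (U B : Type*)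

/-- The bilinear extension of grafting. -/
noncomputable def freeCirc {m n p : ℕ} (i : ℕ) (hi : i < m) (h : p + 1 = m + n) :
    (TreeN U B m →₀ k) →ₗ[k] (TreeN U B n →₀ k) →ₗ[k] (TreeN U B p →₀ k) :=
  Finsupp.linearCombination k fun t => Finsupp.lmapDomain k k (TreeN.circ i hi h t)

theorem freeCirc_single {m n p : ℕ} (i : ℕ) (hi : i < m) (h : p + 1 = m + n)
    (t : TreeN U B m) (s : TreeN U B n) (a b : k) :
    freeCirc k U B i hi h (Finsupp.single t a) (Finsupp.single s b) =
      Finsupp.single (TreeN.circ i hi h t s) (a * b) := by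
  simp [freeCirc]

/-- The free nonsymmetric operad `𝒯(E)` on the arity graded space `E` for which `E₁` has the
basis `U`, `E₂` has the basis `B`, and `Eₙ = 0` for all other `n`. -/
noncomputable def freeOperad : NSOperad k where
  Op n := TreeN U B n →₀ k
  one := Finsupp.single ⟨PTree.leaf, rfl⟩ 1
  circ i hi h := freeCirc k U B i hi h
  one_circ {n} h x := by
    induction x using Finsupp.induction_linear with
    | zero => simp
    | add x y hx hy => rw [map_add, hx, hy]
    | single t a =>
      rw [freeCirc_single, one_mul]
      rfl
  circ_one {m} i hi x := by
    induction x using Finsupp.induction_linear with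
    | zero => simp
    | add x y hx hy => rw [map_add, LinearMap.add_apply, hx, hy]
    | single t a =>
      rw [freeCirc_single, mul_one]
      congr 1
      exact Subtype.ext (PTree.graft_leaf t.1 i)
  circ_assoc {l m n p q r} i j hi hj hij h₁ h₂ h₃ h₄ x y z := by
    induction x using Finsupp.induction_linear with
    | zero => simp
    | add x x' hx hx' => simp only [map_add, LinearMap.add_apply, hx, hx']
    | single t a =>
    induction y using Finsupp.induction_linear with
    | zero => simp
    | add x x' hx hx' => simp only [map_add, LinearMap.add_apply, hx, hx']
    | single s b =>
    induction z using Finsupp.induction_linear with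
    | zero => simp
    | add x x' hx hx' => simp only [map_add, hx, hx']
    | single u c =>
      simp only [freeCirc_single, mul_assoc]
      congr 1
      exact Subtype.ext (PTree.graft_assoc t.1 s.1 u.1 i j (by rw [t.2]; exact hi)
        (by rw [s.2]; exact hj))
  circ_comm {l m n p q r} i j j' hi hj hlt hj'eq hj' hi' h₁ h₂ h₃ h₄ x y z := by
    induction x using Finsupp.induction_linear with
    | zero => simp
    | add x x' hx hx' => simp only [map_add, LinearMap.add_apply, hx, hx']
    | single t a =>
    induction y using Finsupp.induction_linear with
    | zero => simp
    | add x x' hx hx' => simp only [map_add, LinearMap.add_apply, hx, hx']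
    | single s b =>
    induction z using Finsupp.induction_linear with
    | zero => simp
    | add x x' hx hx' => simp only [map_add, LinearMap.add_apply, hx, hx']
    | single u c =>
      simp only [freeCirc_single, mul_assoc, mul_comm b c]
      congr 1
      exact Subtype.ext (PTree.graft_comm t.1 s.1 u.1 i j j' hlt (by rw [t.2]; exact hj)
        (by rw [s.2]; exact hj'eq))

end Free

/-! The trees of weight two (two vertices), sorted by arity. They form bases of the three
components `E₁ ⊗ E₁`, `E₁ ⊗ E₂ ⊕ E₂ ⊗ E₁ ⊕ E₂ ⊗ E₁` and `E₂ ⊗ E₂ ⊕ E₂ ⊗ E₂` of `𝒯(E)⁽²⁾`.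
The first decoration is always that of the vertex next to the root. -/

/-- Arity one: `α ∘₁ β` with `α`, `β` unary. -/
inductive Quad₁ (U : Type*) where
  | circ : U → U → Quad₁ U

/-- Arity two: `α ∘₁ μ`, `μ ∘₁ α` and `μ ∘₂ α` with `α` unary and `μ` binary. -/
inductive Quad₂ (U B : Type*) where
  | outer : U → B → Quad₂ U B
  | left : B → U → Quad₂ U B
  | right : B → U → Quad₂ U B

/-- Arity three: `μ ∘₁ ν` and `μ ∘₂ ν` with `μ`, `ν` binary. -/
inductive Quad₃ (B : Type*) where
  | left : B → B → Quad₃ B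
  | right : B → B → Quad₃ B

namespace Quad₁

variable {U : Type*}

def toTree (B : Type*) : Quad₁ U → TreeN U B 1
  | circ a b => ⟨.un a (.un b .leaf), rfl⟩

/-- The sign of the pairing between `α* ∘₁ β*` and `α ∘₁ β`. -/
def sign : Quad₁ U → ℤ
  | circ _ _ => 1

/-- Replacement of `P_ℓ ∘₁ P_k` by `P_{ν,ℓ} ∘₁ P_{μ,k}`. -/
def label {Ω : Type*} (μ ν : Ω) : Quad₁ U → Quad₁ (Ω × U)
  | circ l k => circ (ν, l) (μ, k)

end Quad₁

namespace Quad₂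

variable {U B : Type*}

def toTree : Quad₂ U B → TreeN U B 2
  | outer a m => ⟨.un a (.bin m .leaf .leaf), rfl⟩
  | left m a => ⟨.bin m (.un a .leaf) .leaf, rfl⟩
  | right m a => ⟨.bin m .leaf (.un a .leaf), rfl⟩

/-- The signs of the pairing in arity two: `-1` for `α ∘₁ μ`, and `1` for `μ ∘₁ α`
and `μ ∘₂ α`. -/
def sign : Quad₂ U B → ℤ
  | outer _ _ => -1
  | left _ _ => 1
  | right _ _ => 1

/-- Replacement of the unary operation `P_k` by `P_{μ,k}` and of the binary operation `i`
by `i_ν`. -/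
def label {Ω : Type*} (μ ν : Ω) : Quad₂ U B → Quad₂ (Ω × U) (Ω × B)
  | outer a m => outer (μ, a) (ν, m)
  | left m a => left (ν, m) (μ, a)
  | right m a => right (ν, m) (μ, a)

end Quad₂

namespace Quad₃

variable {B : Type*}

def toTree (U : Type*) : Quad₃ B → TreeN U B 3
  | left m n => ⟨.bin m (.bin n .leaf .leaf) .leaf, rfl⟩
  | right m n => ⟨.bin m .leaf (.bin n .leaf .leaf), rfl⟩

/-- The signs of the pairing in arity three: `1` for `μ ∘₁ ν` and `-1` for `μ ∘₂ ν`. -/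
def sign : Quad₃ B → ℤ
  | left _ _ => 1
  | right _ _ => -1

/-- Replacement of `j ∘₁ i`, which is `(x i y) j z`, by `j_ν ∘₁ i_μ`, and of `i ∘₂ j`, which is
`x i (y j z)`, by `i_μ ∘₂ j_ν`: the operation that stands first from the left gets `μ`. -/
def label {Ω : Type*} (μ ν : Ω) : Quad₃ B → Quad₃ (Ω × B)
  | left j i => left (ν, j) (μ, i)
  | right i j => right (μ, i) (ν, j)

end Quad₃

/-- The bilinear form `⟨q*, q'⟩ = ± δ_{q,q'}` between the spaces with dual bases indexed
by `X`, with prescribed signs. -/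
noncomputable def signedPairing {k X : Type*} [Field k] (sign : X → ℤ) (x y : X →₀ k) : k :=
  x.sum fun q a => (sign q : k) * a * y q

/-- The orthogonal space with respect to the signed pairing. -/
def signedPerp {k X : Type*} [Field k] (sign : X → ℤ) (R : Set (X →₀ k)) : Set (X →₀ k) :=
  {x | ∀ r ∈ R, signedPairing sign x r = 0}

/-- A quadratic presentation `(E, R)` of a unary binary nonsymmetric operad: `E₁` has the
basis `U`, `E₂` has the basis `B`, and `R = R₁ ⊔ R₂ ⊔ R₃` is sorted by arity. -/
structure QuadPres (k : Type*) [Field k] (U B : Type*) where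
  R₁ : Set (Quad₁ U →₀ k)
  R₂ : Set (Quad₂ U B →₀ k)
  R₃ : Set (Quad₃ B →₀ k)

namespace QuadPres

variable {k : Type*} [Field k] {U B : Type*}

/-- The relations as elements of the free operad. -/
noncomputable def rel (P : QuadPres k U B) : ∀ n, Set ((freeOperad k U B).Op n)
  | 1 => Finsupp.mapDomain (Quad₁.toTree B) '' P.R₁
  | 2 => Finsupp.mapDomain Quad₂.toTree '' P.R₂
  | 3 => Finsupp.mapDomain (Quad₃.toTree U) '' P.R₃
  | _ => ∅

/-- The operad `𝒯(E)/⟨R⟩`. -/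
noncomputable def operad (P : QuadPres k U B) : NSOperad k :=
  (freeOperad k U B).quot ((freeOperad k U B).idealSpan P.rel)
    ((freeOperad k U B).idealSpan_isIdeal P.rel)

/-- The presentation `(E*, R^⊥)` of the Koszul dual operad, for finite dimensional `E`. The basis
of `E*` dual to the given basis of `E` is indexed by the same types. -/
noncomputable def koszulDual [Finite U] [Finite B] (P : QuadPres k U B) : QuadPres k U B where
  R₁ := signedPerp Quad₁.sign P.R₁
  R₂ := signedPerp Quad₂.sign P.R₂
  R₃ := signedPerp Quad₃.sign P.R₃

/-- The presentation of the matching operad with parameter set `Ω`: generators `g_ω` for each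
generator `g` and each `ω : Ω`, and each relation `r` replaced by all relations `r^{μ,ν}`. -/
noncomputable def mat (Ω : Type*) (P : QuadPres k U B) : QuadPres k (Ω × U) (Ω × B) where
  R₁ := ⋃ (μ : Ω) (ν : Ω), Finsupp.mapDomain (Quad₁.label μ ν) '' P.R₁
  R₂ := ⋃ (μ : Ω) (ν : Ω), Finsupp.mapDomain (Quad₂.label μ ν) '' P.R₂
  R₃ := ⋃ (μ : Ω) (ν : Ω), Finsupp.mapDomain (Quad₃.label μ ν) '' P.R₃

/-- The presented operad is isomorphic to its Koszul dual operad. -/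
def IsSelfDual [Finite U] [Finite B] (P : QuadPres k U B) : Prop :=
  Nonempty (NSOperad.Iso P.koszulDual.operad P.operad)

end QuadPres

/-- The presentation with two unary generators `d₁ = 0`, `d₂ = 1` in `Fin 2`, one binary
generator `μ = ()`, and the relations `d₁ d₁`, `d₁ d₂`, the Leibniz rule
`d₁(xy) = d₁(x)y + x d₁(y)`, `d₂(xy) = d₂(x)y`, `d₂(xy) = x d₂(y)` and associativity. -/
noncomputable def twoDerivationPres (k : Type*) [Field k] : QuadPres k (Fin 2) Unit where
  R₁ := {Finsupp.single (.circ 0 0) 1, Finsupp.single (.circ 0 1) 1}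
  R₂ := {Finsupp.single (.outer 0 ()) 1 - Finsupp.single (.left () 0) 1
            - Finsupp.single (.right () 0) 1,
         Finsupp.single (.outer 1 ()) 1 - Finsupp.single (.left () 1) 1,
         Finsupp.single (.outer 1 ()) 1 - Finsupp.single (.right () 1) 1}
  R₃ := {Finsupp.single (.left () ()) 1 - Finsupp.single (.right () ()) 1}

/-! Exchanging $d_1$ and $d_2$ turns the orthogonal relations into the original ones. In arity one,
the orthogonal of $d_1d_1, d_1d_2$ is spanned by $d_2^*d_1^*, d_2^*d_2^*$. In arity two, the sign on
$\alpha\circ_1\mu$ makes the Leibniz functional for $d_1^*$ orthogonal to the two linearity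
relations of $d_1$: the orthogonal has dimension 3 in 6 and consists of the Leibniz rule for $d_2^*$
and both linearity relations for $d_1^*$. In arity three, associativity is its own orthogonal. A
permutation of unary generators that matches the spans of the relations induces an isomorphism of
the quotient operads (`nonempty_iso_of_mapsTo`). For the matching operad, labelling by
$(\mu,\nu)\in\Omega^2$ splits the weight two trees into disjoint copies of the unlabelled ones, with
the same signs. The pairing is the orthogonal sum over these blocks and the matching relations are a
copy of $R$ in each block, so orthogonals are computed blockwise (`signedPerp_iUnion_mapsTo`,
`iUnion_mapsTo_signedPerp`). The swap preserves the blocks, so self-duality passes from $\mathcal P$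
to $\mathrm{mat}(\mathcal P)_\Omega$ (`isSelfDual_mat`). -/

/-! ### Relabelling the unary vertices of trees. -/

namespace PTree

variable {U B : Type*}

/-- Relabelling of the unary vertices. -/
def mapUn (f : U → U) : PTree U B → PTree U B
  | leaf => leaf
  | un a t => un (f a) (t.mapUn f)
  | bin b l r => bin b (l.mapUn f) (r.mapUn f)

theorem leaves_mapUn (f : U → U) (t : PTree U B) : (t.mapUn f).leaves = t.leaves := by
  induction t with
  | leaf => rfl
  | un a t ih => exact ih
  | bin b l r ihl ihr => simp only [mapUn, leaves, ihl, ihr]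

theorem mapUn_graft (f : U → U) (t s : PTree U B) (i : ℕ) :
    (t.graft i s).mapUn f = (t.mapUn f).graft i (s.mapUn f) := by
  induction t generalizing i with
  | leaf => rfl
  | un a t ih => simp only [graft, mapUn, ih]
  | bin b l r ihl ihr =>
    simp only [graft, mapUn, leaves_mapUn]
    split_ifs <;> simp only [mapUn, ihl, ihr]

theorem mapUn_mapUn {f g : U → U} (h : ∀ a, g (f a) = a) (t : PTree U B) :
    (t.mapUn f).mapUn g = t := by
  induction t with
  | leaf => rfl
  | un a t ih => simp only [mapUn, h, ih]
  | bin b l r ihl ihr => simp only [mapUn, ihl, ihr]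

end PTree

namespace TreeN

variable {U B : Type*}

/-- Relabelling of the unary vertices, as a permutation of the trees with `n` leaves. -/
def mapEquiv (B : Type*) (e : U ≃ U) (n : ℕ) : TreeN U B n ≃ TreeN U B n where
  toFun t := ⟨t.1.mapUn e, (PTree.leaves_mapUn e t.1).trans t.2⟩
  invFun t := ⟨t.1.mapUn e.symm, (PTree.leaves_mapUn e.symm t.1).trans t.2⟩
  left_inv t := Subtype.ext (PTree.mapUn_mapUn e.symm_apply_apply t.1)
  right_inv t := Subtype.ext (PTree.mapUn_mapUn e.apply_symm_apply t.1)

theorem mapEquiv_circ (e : U ≃ U) {m n p : ℕ} (i : ℕ) (hi : i < m) (h : p + 1 = m + n)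
    (t : TreeN U B m) (s : TreeN U B n) :
    mapEquiv B e p (circ i hi h t s) = circ i hi h (mapEquiv B e m t) (mapEquiv B e n s) :=
  Subtype.ext (PTree.mapUn_graft e t.1 s.1 i)

end TreeN

/-! ### Ideals and quotients under isomorphisms of operads. -/

namespace NSOperad

variable {k : Type*} [Field k]

theorem span_le_idealSpan (P : NSOperad k) (R : ∀ n, Set (P.Op n)) (n : ℕ) :
    Submodule.span k (R n) ≤ P.idealSpan R n :=
  le_iInf fun I => Submodule.span_le.2 (I.2.2 n)

theorem idealSpan_le {P : NSOperad k} {R : ∀ n, Set (P.Op n)} {I : ∀ n, Submodule k (P.Op n)}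
    (hI : P.IsIdeal I) (h : ∀ n, R n ⊆ I n) (n : ℕ) : P.idealSpan R n ≤ I n :=
  iInf_le (fun J : {I : ∀ n, Submodule k (P.Op n) // P.IsIdeal I ∧ ∀ n, R n ⊆ I n} => J.1 n)
    ⟨I, hI, h⟩

/-- An isomorphism of operads matching two ideals induces an isomorphism of the quotients. -/
noncomputable def Iso.quot {P Q : NSOperad k} (F : Iso P Q) {I : ∀ n, Submodule k (P.Op n)}
    {J : ∀ n, Submodule k (Q.Op n)} (hI : P.IsIdeal I) (hJ : Q.IsIdeal J)
    (h : ∀ n, (I n).map (F.equiv n : P.Op n →ₗ[k] Q.Op n) = J n) :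
    Iso (P.quot I hI) (Q.quot J hJ) where
  equiv n := Submodule.Quotient.equiv (I n) (J n) (F.equiv n) (h n)
  map_one := congrArg (J 1).mkQ F.map_one
  map_circ {m n p} i hi hp x y := by
    obtain ⟨x, rfl⟩ := (I m).mkQ_surjective x
    obtain ⟨y, rfl⟩ := (I n).mkQ_surjective y
    exact congrArg (J p).mkQ (F.map_circ i hi hp x y)

/-- The preimage of an ideal under an isomorphism of operads. -/
theorem IsIdeal.comap {P Q : NSOperad k} (F : Iso P Q) {J : ∀ n, Submodule k (Q.Op n)}
    (hJ : Q.IsIdeal J) :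
    P.IsIdeal fun n => (J n).comap (F.equiv n : P.Op n →ₗ[k] Q.Op n) where
  left {m n p} i hi h x y hx := by
    simp only [Submodule.mem_comap, LinearEquiv.coe_coe, F.map_circ] at hx ⊢
    exact hJ.left i hi h _ _ hx
  right {m n p} i hi h x y hy := by
    simp only [Submodule.mem_comap, LinearEquiv.coe_coe, F.map_circ] at hy ⊢
    exact hJ.right i hi h _ _ hy

end NSOperad

/-! ### Automorphisms of the free operad, and isomorphisms between presented operads. -/

theorem domLCongr_freeCirc {k : Type*} [Field k] {U B : Type*} (e : U ≃ U) {m n p : ℕ} (i : ℕ)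
    (hi : i < m) (h : p + 1 = m + n) (x : TreeN U B m →₀ k) (y : TreeN U B n →₀ k) :
    Finsupp.domLCongr (R := k) (TreeN.mapEquiv B e p) (freeCirc k U B i hi h x y) =
      freeCirc k U B i hi h (Finsupp.domLCongr (R := k) (TreeN.mapEquiv B e m) x)
        (Finsupp.domLCongr (R := k) (TreeN.mapEquiv B e n) y) := by
  induction x using Finsupp.induction_linear with
  | zero => simp
  | add x x' hx hx' => simp only [map_add, LinearMap.add_apply, hx, hx']
  | single t a =>
  induction y using Finsupp.induction_linear with
  | zero => simp
  | add x x' hx hx' => simp only [map_add, hx, hx']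
  | single s b => simp only [freeCirc_single, Finsupp.domLCongr_single, TreeN.mapEquiv_circ]

/-- The automorphism of the free operad given by a permutation of the unary generators. -/
noncomputable def freeRelabel (k : Type*) [Field k] {U : Type*} (B : Type*) (e : U ≃ U) :
    NSOperad.Iso (freeOperad k U B) (freeOperad k U B) where
  equiv n := Finsupp.domLCongr (TreeN.mapEquiv B e n)
  map_one := Finsupp.domLCongr_single _ _ _
  map_circ i hi h x y := domLCongr_freeCirc e i hi h x y

theorem freeRelabel_apply {k : Type*} [Field k] {U B : Type*} (e : U ≃ U) (n : ℕ)
    (x : TreeN U B n →₀ k) :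
    (freeRelabel k B e).equiv n x = Finsupp.mapDomain (TreeN.mapEquiv B e n) x :=
  Finsupp.domLCongr_apply _ _ |>.trans (Finsupp.equivMapDomain_eq_mapDomain _ _)

/-- Relabelling of the unary vertices of the trees with two unary vertices. -/
def Quad₁.mapUn {U : Type*} (f : U → U) : Quad₁ U → Quad₁ U
  | circ a b => circ (f a) (f b)

/-- Relabelling of the unary vertices of the trees with one unary and one binary vertex. -/
def Quad₂.mapUn {U B : Type*} (f : U → U) : Quad₂ U B → Quad₂ U B
  | outer a m => outer (f a) m
  | left m a => left m (f a)
  | right m a => right m (f a)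

namespace QuadPres

variable {k : Type*} [Field k] {U B : Type*}

/-- The relabelling `f` of the unary generators maps the relations of `P` to linear consequences
of the relations of `Q`. -/
structure MapsTo (f : U → U) (P Q : QuadPres k U B) : Prop where
  one : ∀ r ∈ P.R₁, Finsupp.mapDomain (Quad₁.mapUn f) r ∈ Submodule.span k Q.R₁
  two : ∀ r ∈ P.R₂, Finsupp.mapDomain (Quad₂.mapUn f) r ∈ Submodule.span k Q.R₂
  three : ∀ r ∈ P.R₃, r ∈ Submodule.span k Q.R₃

theorem mapDomain_mem_span {X Y : Type*} (f : X → Y) {S : Set (X →₀ k)} {x : X →₀ k}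
    (hx : x ∈ Submodule.span k S) :
    Finsupp.mapDomain f x ∈ Submodule.span k (Finsupp.mapDomain f '' S) :=
  Submodule.apply_mem_span_image_of_mem_span (Finsupp.lmapDomain k k f) hx

/-- The preimage of the ideal of `Q` is an ideal, so only the generating relations of `P` have to be
checked. -/
theorem MapsTo.relabel_mem {e : U ≃ U} {P Q : QuadPres k U B} (h : MapsTo e P Q) (n : ℕ)
    {x : TreeN U B n →₀ k} (hx : x ∈ (freeOperad k U B).idealSpan P.rel n) :
    (freeRelabel k B e).equiv n x ∈ (freeOperad k U B).idealSpan Q.rel n := by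
  refine NSOperad.idealSpan_le (((freeOperad k U B).idealSpan_isIdeal Q.rel).comap
    (freeRelabel k B e)) ?_ n hx
  intro n x hx
  refine (freeOperad k U B).span_le_idealSpan Q.rel n ?_
  refine (congrArg (· ∈ Submodule.span k (Q.rel n)) (freeRelabel_apply e n x)).mpr ?_
  -- In all other arities `rel` is empty.
  match n, x, hx with
  | 1, _, ⟨r, hr, rfl⟩ =>
    have := mapDomain_mem_span (Quad₁.toTree B) (h.one r hr)
    rw [← Finsupp.mapDomain_comp] at this ⊢
    exact this
  | 2, _, ⟨r, hr, rfl⟩ =>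
    have := mapDomain_mem_span Quad₂.toTree (h.two r hr)
    have hq : TreeN.mapEquiv B e 2 ∘ Quad₂.toTree = Quad₂.toTree ∘ Quad₂.mapUn e := by
      funext q
      cases q <;> rfl
    rw [← Finsupp.mapDomain_comp] at this ⊢
    exact hq ▸ this
  | 3, _, ⟨r, hr, rfl⟩ =>
    have := mapDomain_mem_span (Quad₃.toTree U) (h.three r hr)
    have hq : TreeN.mapEquiv B e 3 ∘ Quad₃.toTree U = Quad₃.toTree U := by
      funext q
      cases q <;> rfl
    rw [← Finsupp.mapDomain_comp, hq]
    exact this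

theorem nonempty_iso_of_mapsTo {e : U ≃ U} {P Q : QuadPres k U B} (h : MapsTo e P Q)
    (h' : MapsTo e.symm Q P) : Nonempty (NSOperad.Iso P.operad Q.operad) := by
  refine ⟨(freeRelabel k B e).quot _ _ fun n => le_antisymm ?_ fun x hx => ?_⟩
  · rintro _ ⟨x, hx, rfl⟩
    exact h.relabel_mem n hx
  · refine ⟨((freeRelabel k B e).equiv n).symm x, ?_, LinearEquiv.apply_symm_apply _ _⟩
    -- The inverse of the relabelling by `e` is definitionally the relabelling by `e.symm`.
    exact h'.relabel_mem n hx

end QuadPres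

/-! ### Orthogonal spaces for the signed pairing. -/

section Perp

variable {k X Y ι : Type*} [Field k]

/-- Summing over the support of the fixed right argument makes linearity in `x` visible termwise. -/
theorem signedPairing_eq_sum_right (sign : X → ℤ) (x y : X →₀ k) :
    signedPairing sign x y = y.sum fun q b => (sign q : k) * x q * b := by
  classical
  rw [signedPairing, Finsupp.sum_of_support_subset x (Finset.subset_union_left (s₂ := y.support))
      _ (by simp),
    Finsupp.sum_of_support_subset y (Finset.subset_union_right (s₁ := x.support)) _ (by simp)]

/-- The orthogonal space as a submodule. -/
def signedPerpSubmodule (sign : X → ℤ) (R : Set (X →₀ k)) : Submodule k (X →₀ k) where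
  carrier := signedPerp sign R
  zero_mem' r _ := by simp [signedPairing]
  add_mem' {x y} hx hy r hr := by
    have h₁ := hx r hr
    have h₂ := hy r hr
    rw [signedPairing_eq_sum_right] at h₁ h₂ ⊢
    simp only [Finsupp.add_apply, mul_add, add_mul, Finsupp.sum_add, h₁, h₂, add_zero]
  smul_mem' c x hx r hr := by
    have h₁ := hx r hr
    rw [signedPairing_eq_sum_right] at h₁ ⊢
    have : (r.sum fun q b => (sign q : k) * (c • x) q * b) =
        c * r.sum fun q b => (sign q : k) * x q * b := by
      rw [Finsupp.mul_sum]
      exact Finset.sum_congr rfl fun q _ => by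
        simp only [Finsupp.smul_apply, smul_eq_mul]; ring
    rw [this, h₁, mul_zero]

theorem span_signedPerp (sign : X → ℤ) (R : Set (X →₀ k)) :
    Submodule.span k (signedPerp sign R) = signedPerpSubmodule sign R :=
  Submodule.span_eq (signedPerpSubmodule sign R)

theorem mem_span_signedPerp {sign : X → ℤ} {R : Set (X →₀ k)} {x : X →₀ k} :
    x ∈ Submodule.span k (signedPerp sign R) ↔ x ∈ signedPerp sign R := by
  rw [span_signedPerp]; rfl

/-- Restriction along `f` is adjoint to pushforward along `f`. -/
theorem signedPairing_mapDomain_right {sign : Y → ℤ} {f : X → Y} (hf : f.Injective)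
    (x : Y →₀ k) (r : X →₀ k) :
    signedPairing sign x (Finsupp.mapDomain f r) =
      signedPairing (sign ∘ f) (x.comapDomain f hf.injOn) r := by
  rw [signedPairing_eq_sum_right, signedPairing_eq_sum_right,
    Finsupp.sum_mapDomain_index (by simp) (by intros; ring)]
  rfl

/-! ### Blockwise orthogonality: `Y` is a disjoint union of copies of `X` indexed by `ι`. -/

variable {ℓ : ι → X → Y} (hℓ : Function.Bijective fun p : ι × X => ℓ p.1 p.2)

include hℓ

theorem injective_of_bijective_uncurry (i : ι) : (ℓ i).Injective := fun _ _ h =>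
  (Prod.ext_iff.1 (hℓ.1 (a₁ := (i, _)) (a₂ := (i, _)) h)).2

/-- A finitely supported function on a disjoint union of copies of `X` is the sum of its
restrictions. -/
theorem sum_mapDomain_comapDomain [Fintype ι] (x : Y →₀ k) :
    ∑ i, Finsupp.mapDomain (ℓ i)
      (x.comapDomain (ℓ i) (injective_of_bijective_uncurry hℓ i).injOn) = x := by
  classical
  ext y
  obtain ⟨⟨i, q⟩, rfl⟩ := hℓ.2 y
  rw [Finsupp.finsetSum_apply, Finset.sum_eq_single i]
  · rw [Finsupp.mapDomain_apply (injective_of_bijective_uncurry hℓ i)]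
    rfl
  · intro j _ hj
    refine Finsupp.mapDomain_of_notMem_range _ _ ?_
    rintro ⟨q', hq'⟩
    exact hj (Prod.ext_iff.1 (hℓ.1 (a₁ := (j, q')) (a₂ := (i, q)) hq')).1
  · simp

/-- Testing `x` against the relations of block `i` alone shows that its restriction to that block is
orthogonal to `R`; then `h` applies in each block, and the blocks are summed. -/
theorem signedPerp_iUnion_mapsTo [Finite ι] {sign : Y → ℤ} {sign' : X → ℤ}
    (hs : ∀ i q, sign (ℓ i q) = sign' q) {g : X → X} {g' : Y → Y}
    (hg : ∀ i q, g' (ℓ i q) = ℓ i (g q)) {R S : Set (X →₀ k)}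
    (h : ∀ r ∈ signedPerp sign' R, Finsupp.mapDomain g r ∈ Submodule.span k S)
    {x : Y →₀ k} (hx : x ∈ signedPerp sign (⋃ i, Finsupp.mapDomain (ℓ i) '' R)) :
    Finsupp.mapDomain g' x ∈ Submodule.span k (⋃ i, Finsupp.mapDomain (ℓ i) '' S) := by
  have := Fintype.ofFinite ι
  rw [← sum_mapDomain_comapDomain hℓ x, Finsupp.mapDomain_finsetSum]
  refine Submodule.sum_mem _ fun i _ => ?_
  rw [← Finsupp.mapDomain_comp, show g' ∘ ℓ i = ℓ i ∘ g from funext (hg i),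
    Finsupp.mapDomain_comp]
  refine Submodule.span_mono (Set.subset_iUnion _ i) (QuadPres.mapDomain_mem_span _ (h _ ?_))
  intro r hr
  -- The zero on the right is replaced by the pairing of `x` with the `i`-th copy of `r`.
  rw [← hx _ (Set.mem_iUnion.2 ⟨i, r, hr, rfl⟩),
    signedPairing_mapDomain_right (injective_of_bijective_uncurry hℓ i),
    show sign ∘ ℓ i = sign' from funext (hs i)]

/-- Within one block the pairing vanishes by `h`; elements of different blocks have disjoint
supports. -/
theorem iUnion_mapsTo_signedPerp {sign : Y → ℤ} {sign' : X → ℤ}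
    (hs : ∀ i q, sign (ℓ i q) = sign' q) {g : X → X} {g' : Y → Y}
    (hg : ∀ i q, g' (ℓ i q) = ℓ i (g q)) {R S : Set (X →₀ k)}
    (h : ∀ r ∈ S, Finsupp.mapDomain g r ∈ Submodule.span k (signedPerp sign' R))
    {x : Y →₀ k} (hx : x ∈ ⋃ i, Finsupp.mapDomain (ℓ i) '' S) :
    Finsupp.mapDomain g' x ∈
      Submodule.span k (signedPerp sign (⋃ i, Finsupp.mapDomain (ℓ i) '' R)) := by
  obtain ⟨i, s, hs', rfl⟩ := Set.mem_iUnion.1 hx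
  refine Submodule.subset_span fun r hr => ?_
  obtain ⟨j, r, hr', rfl⟩ := Set.mem_iUnion.1 hr
  rw [← Finsupp.mapDomain_comp, show g' ∘ ℓ i = ℓ i ∘ g from funext (hg i),
    Finsupp.mapDomain_comp, signedPairing_mapDomain_right (injective_of_bijective_uncurry hℓ j),
    show sign ∘ ℓ j = sign' from funext (hs j)]
  by_cases hij : i = j
  · subst hij
    rw [Finsupp.comapDomain_mapDomain _ (injective_of_bijective_uncurry hℓ i)]
    exact mem_span_signedPerp.1 (h s hs') r hr'
  -- For `i ≠ j`, an element of block `i` restricts to zero on block `j`.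
  · convert (signedPerpSubmodule sign' R).zero_mem r hr'
    ext q
    refine Finsupp.mapDomain_of_notMem_range _ _ ?_
    rintro ⟨q', hq'⟩
    exact hij (Prod.ext_iff.1 (hℓ.1 (a₁ := (i, q')) (a₂ := (j, q)) hq')).1

end Perp

/-! ### Each labelled tree of weight two has a unique pair of labels and a unique underlying tree.
-/

section Label

variable (Ω U B : Type*)

theorem Quad₁.label_bijective :
    Function.Bijective fun p : (Ω × Ω) × Quad₁ U => Quad₁.label p.1.1 p.1.2 p.2 := by
  constructor
  · rintro ⟨⟨μ, ν⟩, ⟨a, b⟩⟩ ⟨⟨μ', ν'⟩, ⟨a', b'⟩⟩ h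
    simp only [label, circ.injEq, Prod.mk.injEq] at h ⊢
    tauto
  · rintro ⟨⟨ν, a⟩, ⟨μ, b⟩⟩
    exact ⟨((μ, ν), circ a b), rfl⟩

theorem Quad₂.label_bijective :
    Function.Bijective fun p : (Ω × Ω) × Quad₂ U B => Quad₂.label p.1.1 p.1.2 p.2 := by
  constructor
  · rintro ⟨⟨μ, ν⟩, q⟩ ⟨⟨μ', ν'⟩, q'⟩ h
    cases q <;> cases q' <;>
      simp only [label, outer.injEq, left.injEq, right.injEq, Prod.mk.injEq, reduceCtorEq] at h ⊢
    all_goals tauto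
  · rintro (⟨⟨μ, a⟩, ⟨ν, m⟩⟩ | ⟨⟨ν, m⟩, ⟨μ, a⟩⟩ | ⟨⟨ν, m⟩, ⟨μ, a⟩⟩)
    · exact ⟨((μ, ν), outer a m), rfl⟩
    · exact ⟨((μ, ν), left m a), rfl⟩
    · exact ⟨((μ, ν), right m a), rfl⟩

theorem Quad₃.label_bijective :
    Function.Bijective fun p : (Ω × Ω) × Quad₃ B => Quad₃.label p.1.1 p.1.2 p.2 := by
  constructor
  · rintro ⟨⟨μ, ν⟩, q⟩ ⟨⟨μ', ν'⟩, q'⟩ h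
    cases q <;> cases q' <;>
      simp only [label, left.injEq, right.injEq, Prod.mk.injEq, reduceCtorEq] at h ⊢
    all_goals tauto
  · rintro (⟨⟨ν, j⟩, ⟨μ, i⟩⟩ | ⟨⟨μ, i⟩, ⟨ν, j⟩⟩)
    · exact ⟨((μ, ν), left j i), rfl⟩
    · exact ⟨((μ, ν), right i j), rfl⟩

end Label

/-! ### Matching operads inherit self-duality. -/

namespace QuadPres

variable {k : Type*} [Field k] {U B : Type*}

theorem mat_R₁ (Ω : Type*) (P : QuadPres k U B) : (P.mat Ω).R₁ =
    ⋃ i : Ω × Ω, Finsupp.mapDomain (Quad₁.label i.1 i.2) '' P.R₁ :=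
  (Set.iUnion_prod' fun i : Ω × Ω => Finsupp.mapDomain (Quad₁.label i.1 i.2) '' P.R₁).symm

theorem mat_R₂ (Ω : Type*) (P : QuadPres k U B) : (P.mat Ω).R₂ =
    ⋃ i : Ω × Ω, Finsupp.mapDomain (Quad₂.label i.1 i.2) '' P.R₂ :=
  (Set.iUnion_prod' fun i : Ω × Ω => Finsupp.mapDomain (Quad₂.label i.1 i.2) '' P.R₂).symm

theorem mat_R₃ (Ω : Type*) (P : QuadPres k U B) : (P.mat Ω).R₃ =
    ⋃ i : Ω × Ω, Finsupp.mapDomain (Quad₃.label i.1 i.2) '' P.R₃ :=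
  (Set.iUnion_prod' fun i : Ω × Ω => Finsupp.mapDomain (Quad₃.label i.1 i.2) '' P.R₃).symm

variable [Finite U] [Finite B]

theorem MapsTo.koszulDual_mat {f : U → U} {P Q : QuadPres k U B} (h : MapsTo f P.koszulDual Q)
    (Ω : Type*) [Finite Ω] : MapsTo (Prod.map id f) (P.mat Ω).koszulDual (Q.mat Ω) where
  one r hr := by
    simp only [koszulDual, mat_R₁] at hr ⊢
    exact signedPerp_iUnion_mapsTo (Quad₁.label_bijective Ω U) (sign' := Quad₁.sign)
      (by rintro _ ⟨⟩; rfl) (g := Quad₁.mapUn f) (by rintro _ ⟨⟩; rfl) h.one hr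
  two r hr := by
    simp only [koszulDual, mat_R₂] at hr ⊢
    exact signedPerp_iUnion_mapsTo (Quad₂.label_bijective Ω U B) (sign' := Quad₂.sign)
      (by rintro _ ⟨⟩ <;> rfl) (g := Quad₂.mapUn f) (by rintro _ ⟨⟩ <;> rfl) h.two hr
  three r hr := by
    simp only [koszulDual, mat_R₃] at hr ⊢
    -- This gives the goal the form of the block lemma, with the identity as relabelling.
    rw [← Finsupp.mapDomain_id (v := r)]
    exact signedPerp_iUnion_mapsTo (Quad₃.label_bijective Ω B) (sign' := Quad₃.sign)
      (by rintro _ ⟨⟩ <;> rfl) (g := id) (by rintro _ ⟨⟩ <;> rfl)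
      (fun r hr => by rw [Finsupp.mapDomain_id]; exact h.three r hr) hr

theorem MapsTo.mat_koszulDual {f : U → U} {P Q : QuadPres k U B} (h : MapsTo f Q P.koszulDual)
    (Ω : Type*) [Finite Ω] : MapsTo (Prod.map id f) (Q.mat Ω) (P.mat Ω).koszulDual where
  one r hr := by
    simp only [koszulDual, mat_R₁] at hr ⊢
    exact iUnion_mapsTo_signedPerp (Quad₁.label_bijective Ω U) (sign' := Quad₁.sign)
      (by rintro _ ⟨⟩; rfl) (g := Quad₁.mapUn f) (by rintro _ ⟨⟩; rfl) h.one hr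
  two r hr := by
    simp only [koszulDual, mat_R₂] at hr ⊢
    exact iUnion_mapsTo_signedPerp (Quad₂.label_bijective Ω U B) (sign' := Quad₂.sign)
      (by rintro _ ⟨⟩ <;> rfl) (g := Quad₂.mapUn f) (by rintro _ ⟨⟩ <;> rfl) h.two hr
  three r hr := by
    simp only [koszulDual, mat_R₃] at hr ⊢
    rw [← Finsupp.mapDomain_id (v := r)]
    exact iUnion_mapsTo_signedPerp (Quad₃.label_bijective Ω B) (sign' := Quad₃.sign)
      (by rintro _ ⟨⟩ <;> rfl) (g := id) (by rintro _ ⟨⟩ <;> rfl)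
      (fun r hr => by rw [Finsupp.mapDomain_id]; exact h.three r hr) hr

/-- If a permutation of the unary generators identifies the relations of the Koszul dual with those
of `P`, then all the matching operads of `P` are self-dual. -/
theorem isSelfDual_mat {e : U ≃ U} {P : QuadPres k U B} (h : MapsTo e P.koszulDual P)
    (h' : MapsTo e.symm P P.koszulDual) (Ω : Type*) [Finite Ω] : (P.mat Ω).IsSelfDual :=
  nonempty_iso_of_mapsTo (e := (Equiv.refl Ω).prodCongr e) (h.koszulDual_mat Ω)
    (h'.mat_koszulDual Ω)

end QuadPres

/-! ### The swap of $d_1$ and $d_2$, in coordinates. -/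

section TwoDerivation

variable {k : Type*} [Field k]

theorem signedPairing_sub_right {X : Type*} (sign : X → ℤ) (x y z : X →₀ k) :
    signedPairing sign x (y - z) = signedPairing sign x y - signedPairing sign x z := by
  simp [signedPairing, mul_sub, Finsupp.sum_sub]

theorem signedPairing_single_right {X : Type*} (sign : X → ℤ) (x : X →₀ k) (q : X) (b : k) :
    signedPairing sign x (Finsupp.single q b) = sign q * x q * b := by
  rw [signedPairing_eq_sum_right, Finsupp.sum_single_index (by simp)]

theorem Quad₁.eq_sum_single (x : Quad₁ (Fin 2) →₀ k) :
    x = Finsupp.single (.circ 0 0) (x (.circ 0 0)) + Finsupp.single (.circ 0 1) (x (.circ 0 1)) +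
      Finsupp.single (.circ 1 0) (x (.circ 1 0)) + Finsupp.single (.circ 1 1) (x (.circ 1 1)) := by
  classical
  ext ⟨a, b⟩
  fin_cases a <;> fin_cases b <;> simp

theorem Quad₂.eq_sum_single (x : Quad₂ (Fin 2) Unit →₀ k) :
    x = Finsupp.single (.outer 0 ()) (x (.outer 0 ())) +
      Finsupp.single (.left () 0) (x (.left () 0)) +
      Finsupp.single (.right () 0) (x (.right () 0)) +
      Finsupp.single (.outer 1 ()) (x (.outer 1 ())) +
      Finsupp.single (.left () 1) (x (.left () 1)) +
      Finsupp.single (.right () 1) (x (.right () 1)) := by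
  classical
  ext q
  rcases q with ⟨a, _⟩ | ⟨_, a⟩ | ⟨_, a⟩ <;> fin_cases a <;> simp

theorem Quad₃.eq_sum_single (x : Quad₃ Unit →₀ k) :
    x = Finsupp.single (.left () ()) (x (.left () ())) +
      Finsupp.single (.right () ()) (x (.right () ())) := by
  classical
  ext q
  rcases q with ⟨_, _⟩ | ⟨_, _⟩ <;> simp

theorem twoDerivationPres_koszulDual_mapsTo :
    QuadPres.MapsTo (Equiv.swap (0 : Fin 2) 1) (twoDerivationPres k).koszulDual
      (twoDerivationPres k) where
  one x hx := by
    have h₁ := hx (Finsupp.single (.circ 0 0) 1) (by simp [twoDerivationPres])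
    have h₂ := hx (Finsupp.single (.circ 0 1) 1) (by simp [twoDerivationPres])
    simp only [signedPairing_single_right, Quad₁.sign, Int.cast_one, one_mul, mul_one] at h₁ h₂
    rw [Quad₁.eq_sum_single x, h₁, h₂]
    simp only [Finsupp.mapDomain_add, Finsupp.mapDomain_single, Quad₁.mapUn,
      Equiv.swap_apply_left, Equiv.swap_apply_right, Finsupp.single_zero, zero_add]
    -- The swap sends $d_2d_2$ to $d_1d_1$ and $d_2d_1$ to $d_1d_2$.
    refine Submodule.mem_span_pair.2 ⟨x (.circ 1 1), x (.circ 1 0), ?_⟩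
    simp only [Finsupp.smul_single, smul_eq_mul, mul_one]
    abel
  two x hx := by
    have h₁ := hx _ (Or.inl rfl)
    have h₂ := hx _ (Or.inr (Or.inl rfl))
    have h₃ := hx _ (Or.inr (Or.inr rfl))
    simp only [signedPairing_sub_right, signedPairing_single_right, Quad₂.sign, Int.cast_one,
      Int.cast_neg, one_mul, mul_one, neg_one_mul] at h₁ h₂ h₃
    rw [Quad₂.eq_sum_single x]
    simp only [Finsupp.mapDomain_add, Finsupp.mapDomain_single, Quad₂.mapUn,
      Equiv.swap_apply_left, Equiv.swap_apply_right]
    -- After the swap, only the Leibniz rule contains $d_1\circ_1\mu$, and each linearity relation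
    -- is the only one to contain $\mu\circ_1 d_2$, respectively $\mu\circ_2 d_2$, with coefficient
    -- $-1$; this forces the coefficients.
    refine Submodule.mem_span_triple.2
      ⟨x (.outer 1 ()), -x (.left () 0), -x (.right () 0), ?_⟩
    rw [show x (.left () 1) = -x (.outer 1 ()) by linear_combination -h₂,
      show x (.right () 1) = -x (.outer 1 ()) by linear_combination -h₃,
      show x (.outer 0 ()) = -x (.left () 0) + -x (.right () 0) by linear_combination -h₁]
    simp only [smul_sub, Finsupp.smul_single, smul_eq_mul, mul_one, Finsupp.single_add,
      Finsupp.single_neg]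
    abel
  three x hx := by
    have h₁ := hx _ rfl
    simp only [signedPairing_sub_right, signedPairing_single_right, Quad₃.sign, Int.cast_one,
      Int.cast_neg, one_mul, mul_one, neg_one_mul] at h₁
    rw [Quad₃.eq_sum_single x]
    refine Submodule.mem_span_singleton.2 ⟨x (.left () ()), ?_⟩
    rw [show x (.right () ()) = -x (.left () ()) by linear_combination h₁]
    simp only [smul_sub, Finsupp.smul_single, smul_eq_mul, mul_one, Finsupp.single_neg]
    abel

theorem twoDerivationPres_mapsTo_koszulDual :
    QuadPres.MapsTo (Equiv.swap (0 : Fin 2) 1) (twoDerivationPres k)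
      (twoDerivationPres k).koszulDual where
  one x hx := by
    classical
    -- It remains to see that each swapped relation pairs to zero with each relation, a finite
    -- check.
    refine Submodule.subset_span fun r hr => ?_
    rcases hx with rfl | rfl <;> rcases hr with rfl | rfl <;>
      simp [Finsupp.mapDomain_single, Quad₁.mapUn, signedPairing_single_right]
  two x hx := by
    classical
    refine Submodule.subset_span fun r hr => ?_
    rcases hx with rfl | rfl | rfl <;> rcases hr with rfl | rfl | rfl <;>
      simp [Finsupp.mapDomain_single, Finsupp.mapDomain_sub, Quad₂.mapUn, Quad₂.sign,
        signedPairing_sub_right, signedPairing_single_right]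
  three x hx := by
    classical
    refine Submodule.subset_span fun r hr => ?_
    rcases hx with rfl
    rcases hr with rfl
    simp [signedPairing_sub_right, signedPairing_single_right, Quad₃.sign]

end TwoDerivation

theorem mainTheorem9 (k : Type*) [Field k] [CharZero k] :
    (twoDerivationPres k).IsSelfDual ∧
      ∀ (Ω : Type*) [Finite Ω] [Nonempty Ω],
        ((twoDerivationPres k).mat Ω).IsSelfDual :=
  -- The swap is definitionally its own inverse as a function, so the second lemma also serves for
  -- `e.symm`.
  ⟨QuadPres.nonempty_iso_of_mapsTo (e := Equiv.swap 0 1) twoDerivationPres_koszulDual_mapsTo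
      twoDerivationPres_mapsTo_koszulDual,
    fun Ω _ _ => QuadPres.isSelfDual_mat (e := Equiv.swap 0 1) twoDerivationPres_koszulDual_mapsTo
      twoDerivationPres_mapsTo_koszulDual Ω⟩
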